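/- Let $\mathtt{Prop}$ be a countable set of propositional variables. Let $\mathscr{L}_{\mathsf{CPL}}$ be the set of classical propositional formulas $\phi ::= p\mid{\sim}\phi\mid(\phi\wedge\phi)$, $p\in\mathtt{Prop}$, with $\phi\supset\chi:={\sim}(\phi\wedge{\sim}\chi)$, and write $\mathsf{CPL}\vdash\phi$ if $\phi$ is provable in classical propositional logic. Let $\mathscr{L}_{\mathsf{QG}}$ be given by $$\alpha ::= \mathtt{B}\phi\mid(\alpha\wedge\alpha)\mid(\alpha\vee\alpha)\mid(\alpha\to\alpha)\mid(\alpha\prec\alpha)\qquad(\phi\in\mathscr{L}_{\mathsf{CPL}}),$$ and abbreviate $\top:=\tau\to\tau$, $\bot:=\tau\prec\tau$ (for any $\tau\in\mathscr{L}_{\mathsf{QG}}$), $\neg\alpha:=\alpha\to\bot$ and $\triangle\alpha:=(\top\prec\alpha)\to\bot$. *Semantics.* A model consists of a non-empty set $W$, a valuation $v:\mathtt{Prop}\to2^W$ and an uncertainty measure $\mu:2^W\to[0,1]$, i.e. $X\subseteq Y$ implies $\mu(X)\le\mu(Y)$, and $\mu(\varnothing)<\mu(W)$. Classical formulas are evaluated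 at the points of $W$ as usual; let $\|\phi\|\subseteq W$ be the set of points where $\phi$ holds. The value $e(\alpha)\in[0,1]$ is defined by $e(\mathtt{B}\phi)=\mu(\|\phi\|)$, $e(\alpha\wedge\beta)=\min(e(\alpha),e(\beta))$, $e(\alpha\vee\beta)=\max(e(\alpha),e(\beta))$; $e(\alpha\to\beta)=1$ if $e(\alpha)\le e(\beta)$ and $e(\alpha\to\beta)=e(\beta)$ otherwise; $e(\alpha\prec\beta)=0$ if $e(\alpha)\le e(\beta)$ and $e(\alpha\prec\beta)=e(\alpha)$ otherwise. For $\Xi\cup\{\alpha\}\subseteq\mathscr{L}_{\mathsf{QG}}$, write $\Xi\models_{\mathsf{QG}}\alpha$ if $\inf\{e(\gamma):\gamma\in\Xi\}\le e(\alpha)$ in every model (with $\inf\varnothing=1$). *Calculus.* $\mathcal{H}\mathsf{QG}$ has the following axioms, for all $\alpha,\beta,\gamma\in\mathscr{L}_{\mathsf{QG}}$ and $\phi,\chi\in\mathscr{L}_{\mathsf{CPL}}$: 1. $(\alpha\to\beta)\to((\beta\to\gamma)\to(\alpha\to\gamma))$; 2. $\alpha\to(\alpha\vee\beta)$; $\beta\to(\alpha\vee\beta)$;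 3. $(\alpha\to\gamma)\to((\beta\to\gamma)\to((\alpha\vee\beta)\to\gamma))$; 4. $(\alpha\wedge\beta)\to\alpha$; $(\alpha\wedge\beta)\to\beta$; 5. $(\alpha\to\beta)\to((\alpha\to\gamma)\to(\alpha\to(\beta\wedge\gamma)))$; 6. $(\alpha\to(\beta\to\gamma))\to((\alpha\wedge\beta)\to\gamma)$; $((\alpha\wedge\beta)\to\gamma)\to(\alpha\to(\beta\to\gamma))$; 7. $(\alpha\to\beta)\to(\neg\beta\to\neg\alpha)$; 8. $(\alpha\prec\beta)\to(\top\prec(\alpha\to\beta))$; $\neg(\alpha\prec\beta)\to(\alpha\to\beta)$; 9. $\alpha\to(\beta\vee(\alpha\prec\beta))$; $((\alpha\prec\beta)\prec\gamma)\to(\alpha\prec(\beta\vee\gamma))$; 10. (prelinearity) $(\alpha\to\beta)\vee(\beta\to\alpha)$; $\neg((\alpha\prec\beta)\wedge(\beta\prec\alpha))$; 11. (nontriv) $\neg\triangle(\mathtt{B}\phi\to\mathtt{B}\chi)$ whenever $\mathsf{CPL}\vdash\phi$ and $\mathsf{CPL}\vdash{\sim}\chi$; 12. (reg) $\mathtt{B}\phi\to\mathtt{B}\chi$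 whenever $\mathsf{CPL}\vdash\phi\supset\chi$. The rules are modus ponens (from $\alpha$ and $\alpha\to\beta$ infer $\beta$) and necessitation, which applies to theorems only (from $\vdash\alpha$ infer $\vdash\triangle\alpha$). Write $\Xi\vdash_{\mathcal{H}\mathsf{QG}}\alpha$ if $\alpha$ has a finite derivation in which every formula is an axiom, a member of $\Xi$, or obtained by a rule, necessitation being applied only to formulas derivable from no assumptions. **Theorem.** For every (possibly infinite) set $\Xi\cup\{\alpha\}\subseteq\mathscr{L}_{\mathsf{QG}}$, $$\Xi\models_{\mathsf{QG}}\alpha\quad\text{if and only if}\quad\Xi\vdash_{\mathcal{H}\mathsf{QG}}\alpha.$$ -/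

import Mathlib

universe u w

/-- Formulas of classical propositional logic over the variables `V`,
in the language with negation and conjunction. -/
inductive CPLForm (V : Type u) : Type u
  | var (p : V) : CPLForm V
  | neg (φ : CPLForm V) : CPLForm V
  | and (φ ψ : CPLForm V) : CPLForm V

namespace CPLForm

/-- The defined material implication `φ ⊃ ψ := ∼(φ ∧ ∼ψ)`. -/
def imp {V : Type u} (φ ψ : CPLForm V) : CPLForm V :=
  neg (and φ (neg ψ))

/-- Natural deduction for classical propositional logic in the language `{∼, ∧}`. -/
inductive Deriv {V : Type u} : Set (CPLForm V) → CPLForm V → Prop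
  | hyp {Γ : Set (CPLForm V)} {φ : CPLForm V} (h : φ ∈ Γ) : Deriv Γ φ
  | andI {Γ : Set (CPLForm V)} {φ ψ : CPLForm V}
      (h₁ : Deriv Γ φ) (h₂ : Deriv Γ ψ) : Deriv Γ (and φ ψ)
  | andE₁ {Γ : Set (CPLForm V)} {φ ψ : CPLForm V} (h : Deriv Γ (and φ ψ)) : Deriv Γ φ
  | andE₂ {Γ : Set (CPLForm V)} {φ ψ : CPLForm V} (h : Deriv Γ (and φ ψ)) : Deriv Γ ψ
  | negI {Γ : Set (CPLForm V)} {φ ψ : CPLForm V}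
      (h₁ : Deriv (insert φ Γ) ψ) (h₂ : Deriv (insert φ Γ) (neg ψ)) : Deriv Γ (neg φ)
  | raa {Γ : Set (CPLForm V)} {φ ψ : CPLForm V}
      (h₁ : Deriv (insert (neg φ) Γ) ψ) (h₂ : Deriv (insert (neg φ) Γ) (neg ψ)) : Deriv Γ φ

/-- `CPL ⊢ φ`. -/
def Provable {V : Type u} (φ : CPLForm V) : Prop :=
  Deriv ∅ φ

end CPLForm

/-- Two-layered formulas: atoms are `B φ` with `φ` classical, and the outer connectives
are those of bi-Gödel logic. -/
inductive QGForm (V : Type u) : Type u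
  | bel (φ : CPLForm V) : QGForm V
  | and (α β : QGForm V) : QGForm V
  | or (α β : QGForm V) : QGForm V
  | imp (α β : QGForm V) : QGForm V
  | coimp (α β : QGForm V) : QGForm V

namespace QGForm

/-- `⊤ := τ → τ`; the formula `τ` plays the role of the variable in the abbreviation. -/
def top {V : Type u} (τ : QGForm V) : QGForm V := imp τ τ

/-- `⊥ := τ ⤙ τ`. -/
def bot {V : Type u} (τ : QGForm V) : QGForm V := coimp τ τ

/-- Gödel negation `α → ⊥`. -/
def neg {V : Type u} (τ α : QGForm V) : QGForm V := imp α (bot τ)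

/-- `△α := (⊤ ⤙ α) → ⊥`. -/
def delta {V : Type u} (τ α : QGForm V) : QGForm V := imp (coimp (top τ) α) (bot τ)

end QGForm

open QGForm in
/-- The instances, with two-layered formulas, of the axiom schemas of the Hilbert calculus
for bi-Gödel logic. In the schemas that mention `⊤` or `⊥`, the auxiliary formula `τ` in
these abbreviations is arbitrary. -/
inductive BiGAxiom {V : Type u} : QGForm V → Prop
  | trans (φ χ ψ : QGForm V) :
      BiGAxiom (imp (imp φ χ) (imp (imp χ ψ) (imp φ ψ)))
  | orI₁ (φ χ : QGForm V) : BiGAxiom (imp φ (or φ χ))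
  | orI₂ (φ χ : QGForm V) : BiGAxiom (imp χ (or φ χ))
  | orE (φ χ ψ : QGForm V) :
      BiGAxiom (imp (imp φ ψ) (imp (imp χ ψ) (imp (or φ χ) ψ)))
  | andE₁ (φ χ : QGForm V) : BiGAxiom (imp (and φ χ) φ)
  | andE₂ (φ χ : QGForm V) : BiGAxiom (imp (and φ χ) χ)
  | andI (φ χ ψ : QGForm V) :
      BiGAxiom (imp (imp φ χ) (imp (imp φ ψ) (imp φ (and χ ψ))))
  | uncurry (φ χ ψ : QGForm V) :
      BiGAxiom (imp (imp φ (imp χ ψ)) (imp (and φ χ) ψ))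
  | curry (φ χ ψ : QGForm V) :
      BiGAxiom (imp (imp (and φ χ) ψ) (imp φ (imp χ ψ)))
  | contra (τ φ χ : QGForm V) :
      BiGAxiom (imp (imp φ χ) (imp (neg τ χ) (neg τ φ)))
  | coimp_top (τ φ χ : QGForm V) :
      BiGAxiom (imp (coimp φ χ) (coimp (top τ) (imp φ χ)))
  | neg_coimp (τ φ χ : QGForm V) :
      BiGAxiom (imp (neg τ (coimp φ χ)) (imp φ χ))
  | coimp_or (φ χ : QGForm V) : BiGAxiom (imp φ (or χ (coimp φ χ)))
  | coimp_coimp (φ χ ψ : QGForm V) :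
      BiGAxiom (imp (coimp (coimp φ χ) ψ) (coimp φ (or χ ψ)))
  | prel (φ χ : QGForm V) : BiGAxiom (or (imp φ χ) (imp χ φ))
  | coprel (τ φ χ : QGForm V) :
      BiGAxiom (neg τ (and (coimp φ χ) (coimp χ φ)))

/-- Derivability from a set of assumptions in the two-layered calculus. The necessitation
rule applies only to theorems, i.e. to formulas derived from no assumptions. -/
inductive QGDerivable {V : Type u} : Set (QGForm V) → QGForm V → Prop
  | hyp {Ξ : Set (QGForm V)} {α : QGForm V} (h : α ∈ Ξ) : QGDerivable Ξ α
  | biG {Ξ : Set (QGForm V)} {α : QGForm V} (h : BiGAxiom α) : QGDerivable Ξ α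
  | nontriv {Ξ : Set (QGForm V)} (τ : QGForm V) {φ χ : CPLForm V}
      (hφ : φ.Provable) (hχ : χ.neg.Provable) :
      QGDerivable Ξ (QGForm.neg τ (QGForm.delta τ (QGForm.imp (QGForm.bel φ) (QGForm.bel χ))))
  | reg {Ξ : Set (QGForm V)} {φ φ' : CPLForm V} (h : (φ.imp φ').Provable) :
      QGDerivable Ξ (QGForm.imp (QGForm.bel φ) (QGForm.bel φ'))
  | mp {Ξ : Set (QGForm V)} {α β : QGForm V}
      (h₁ : QGDerivable Ξ α) (h₂ : QGDerivable Ξ (QGForm.imp α β)) : QGDerivable Ξ β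
  | nec {Ξ : Set (QGForm V)} (τ : QGForm V) {α : QGForm V}
      (h : QGDerivable ∅ α) : QGDerivable Ξ (QGForm.delta τ α)

/-- An uncertainty measure on `W`: a monotone and non-trivial function from the powerset
of `W` to `[0,1]`. -/
structure UncertaintyMeasure (W : Type w) where
  /-- the underlying set function -/
  toFun : Set W → unitInterval
  mono : ∀ X Y : Set W, X ⊆ Y → toFun X ≤ toFun Y
  nontrivial : toFun ∅ < toFun Set.univ

/-- A model of the two-layered logic: a non-empty set of states with an uncertainty measure
and a classical valuation of the variables. The outer valuation is determined by these
(see `QGModel.eval`). -/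
structure QGModel (V : Type u) where
  /-- the set of states -/
  W : Type w
  nonempty : Nonempty W
  /-- the valuation of the propositional variables -/
  v : V → Set W
  /-- the uncertainty measure -/
  μ : UncertaintyMeasure W

namespace QGModel

/-- Satisfaction of classical formulas at a state. -/
def Sat {V : Type u} (M : QGModel.{u, w} V) (x : M.W) : CPLForm V → Prop
  | .var p => x ∈ M.v p
  | .neg φ => ¬ M.Sat x φ
  | .and φ ψ => M.Sat x φ ∧ M.Sat x ψ

/-- The event `‖φ‖`. -/
def ext {V : Type u} (M : QGModel.{u, w} V) (φ : CPLForm V) : Set M.W :=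
  {x | M.Sat x φ}

end QGModel

noncomputable section

/-- Gödel implication on `[0,1]`. -/
def goedelImp (a b : unitInterval) : unitInterval := if a ≤ b then 1 else b

/-- Gödel co-implication `b ⤙ a` on `[0,1]`. -/
def goedelCoimp (b a : unitInterval) : unitInterval := if b ≤ a then 0 else b

/-- The value of a two-layered formula in a model: the bi-Gödel valuation with
`e (B φ) = μ ‖φ‖`. -/
def QGModel.eval {V : Type u} (M : QGModel.{u, w} V) : QGForm V → unitInterval
  | .bel φ => M.μ.toFun (M.ext φ)
  | .and α β => min (M.eval α) (M.eval β)
  | .or α β => max (M.eval α) (M.eval β)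
  | .imp α β => goedelImp (M.eval α) (M.eval β)
  | .coimp α β => goedelCoimp (M.eval α) (M.eval β)

/-- Entailment over all models: in every model, the infimum (in `[0,1]`, so that the infimum
of the empty set is `1`) of the values of the premises is at most the value of the
conclusion. -/
def QGEntails {V : Type u} (Ξ : Set (QGForm V)) (α : QGForm V) : Prop :=
  ∀ M : QGModel.{u, w} V, sInf (M.eval '' Ξ) ≤ M.eval α

end

/-! Soundness is an induction on derivations. Necessitation is sound because it applies only to
formulas that have value 1 in every model. For completeness, suppose `Ξ` does not derive `α`.
Derivability is finitary, so `Ξ` extends to a prime theory `F` omitting `α`. Put `α ≤ β` when `△(α →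
β) ∈ F`. The calculus proves `△(α → β) ∨ △(β → α)`, so this preorder is total, and the other derived
laws of `△` make each outer connective act on it as its bi-Gödel operation. Since there are
countably many formulas, the preorder is represented by reals in `[0,1]`, with `⊤` at 1 and `⊥` at
0. An infinite `Ξ` needs more than `α` lying below each premise: the infimum of the premises must
exceed the value of `α`. `F` is an up-set, so a gap can be opened between it and its complement
without changing the order. The model has all classical valuations as states, and the measure of `X`
is the supremum of the values of `B φ` with `‖φ‖ ⊆ X`. By classical completeness, (reg) gives `μ
‖φ‖` the value of `B φ`, and (nontriv) makes the measure non-trivial. -/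

/-! ### Classical logic: soundness and finiteness of derivations -/

namespace CPLForm

variable {V : Type u}

/-- Classical truth under a valuation of the variables. -/
def Holds (v : V → Prop) : CPLForm V → Prop
  | .var p => v p
  | .neg φ => ¬ Holds v φ
  | .and φ ψ => Holds v φ ∧ Holds v ψ

theorem Deriv.weaken {Γ : Set (CPLForm V)} {φ : CPLForm V} (h : Deriv Γ φ) :
    ∀ {Δ : Set (CPLForm V)}, Γ ⊆ Δ → Deriv Δ φ := by
  induction h with
  | hyp h => exact fun hs => .hyp (hs h)
  | andI _ _ ih₁ ih₂ => exact fun hs => .andI (ih₁ hs) (ih₂ hs)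
  | andE₁ _ ih => exact fun hs => .andE₁ (ih hs)
  | andE₂ _ ih => exact fun hs => .andE₂ (ih hs)
  | negI _ _ ih₁ ih₂ =>
    exact fun hs => .negI (ih₁ (Set.insert_subset_insert hs)) (ih₂ (Set.insert_subset_insert hs))
  | raa _ _ ih₁ ih₂ =>
    exact fun hs => .raa (ih₁ (Set.insert_subset_insert hs)) (ih₂ (Set.insert_subset_insert hs))

theorem Deriv.sound {Γ : Set (CPLForm V)} {φ : CPLForm V} (h : Deriv Γ φ) (v : V → Prop) :
    (∀ ψ ∈ Γ, Holds v ψ) → Holds v φ := by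
  induction h with
  | hyp h => exact fun hs => hs _ h
  | andI _ _ ih₁ ih₂ => exact fun hs => ⟨ih₁ hs, ih₂ hs⟩
  | andE₁ _ ih => exact fun hs => (ih hs).1
  | andE₂ _ ih => exact fun hs => (ih hs).2
  | negI _ _ ih₁ ih₂ =>
    intro hs hφ
    have h' := (Set.forall_mem_insert (P := Holds v)).2 ⟨hφ, hs⟩
    exact ih₂ h' (ih₁ h')
  | raa _ _ ih₁ ih₂ =>
    intro hs
    by_contra hφ
    have h' := (Set.forall_mem_insert (P := Holds v) (a := neg _)).2 ⟨hφ, hs⟩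
    exact ih₂ h' (ih₁ h')

/-- Serves the two rules that discharge an assumption: the discharged `χ` is removed from the finite
support and then reinserted explicitly. -/
theorem exists_finite_union_of_insert {Γ : Set (CPLForm V)} {χ φ ψ : CPLForm V}
    (h₁ : ∃ s ⊆ insert χ Γ, s.Finite ∧ Deriv s φ) (h₂ : ∃ s ⊆ insert χ Γ, s.Finite ∧ Deriv s ψ) :
    ∃ s ⊆ Γ, s.Finite ∧ Deriv (insert χ s) φ ∧ Deriv (insert χ s) ψ := by
  obtain ⟨s, hs, fs, ds⟩ := h₁
  obtain ⟨t, ht, ft, dt⟩ := h₂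
  refine ⟨(s ∪ t) \ {χ}, ?_, (fs.union ft).sdiff, ds.weaken ?_, dt.weaken ?_⟩
  · rintro x ⟨hx, hxχ⟩
    exact (Set.union_subset hs ht hx).resolve_left hxχ
  · rw [Set.insert_sdiff_singleton]
    exact Set.subset_union_left.trans (Set.subset_insert _ _)
  · rw [Set.insert_sdiff_singleton]
    exact Set.subset_union_right.trans (Set.subset_insert _ _)

theorem Deriv.exists_finite {Γ : Set (CPLForm V)} {φ : CPLForm V} (h : Deriv Γ φ) :
    ∃ s ⊆ Γ, s.Finite ∧ Deriv s φ := by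
  induction h with
  | @hyp Γ φ h =>
    exact ⟨{φ}, Set.singleton_subset_iff.2 h, Set.finite_singleton _, .hyp rfl⟩
  | andI _ _ ih₁ ih₂ =>
    obtain ⟨s, hs, fs, ds⟩ := ih₁
    obtain ⟨t, ht, ft, dt⟩ := ih₂
    exact ⟨s ∪ t, Set.union_subset hs ht, fs.union ft,
      .andI (ds.weaken Set.subset_union_left) (dt.weaken Set.subset_union_right)⟩
  | andE₁ _ ih => obtain ⟨s, hs, fs, ds⟩ := ih; exact ⟨s, hs, fs, .andE₁ ds⟩
  | andE₂ _ ih => obtain ⟨s, hs, fs, ds⟩ := ih; exact ⟨s, hs, fs, .andE₂ ds⟩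
  | negI _ _ ih₁ ih₂ =>
    obtain ⟨s, hs, fs, d₁, d₂⟩ := exists_finite_union_of_insert ih₁ ih₂
    exact ⟨s, hs, fs, .negI d₁ d₂⟩
  | raa _ _ ih₁ ih₂ =>
    obtain ⟨s, hs, fs, d₁, d₂⟩ := exists_finite_union_of_insert ih₁ ih₂
    exact ⟨s, hs, fs, .raa d₁ d₂⟩

end CPLForm

/-- Lindenbaum's lemma for a finitary, monotone property of sets: a set without the property
extends to a maximal one. -/
theorem exists_maximal_not_of_finitary {X : Type*} (P : Set X → Prop)
    (mono : ∀ s t, s ⊆ t → P s → P t) (fin : ∀ s, P s → ∃ t ⊆ s, t.Finite ∧ P t)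
    {s : Set X} (hs : ¬ P s) : ∃ m, s ⊆ m ∧ ¬ P m ∧ ∀ x, x ∉ m → P (insert x m) := by
  obtain ⟨m, hsm, hm⟩ := zorn_subset_nonempty {t | ¬ P t} (fun c hc hchain hne => by
    refine ⟨⋃₀ c, fun hP => ?_, fun t ht => Set.subset_sUnion_of_mem ht⟩
    obtain ⟨t, hts, ft, hPt⟩ := fin _ hP
    obtain ⟨u, hu, htu⟩ := DirectedOn.exists_mem_subset_of_finite_of_subset_sUnion hne
      hchain.directedOn ft hts
    exact hc hu (mono _ _ htu hPt)) s hs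
  refine ⟨m, hsm, hm.prop, fun x hx => ?_⟩
  by_contra hP
  exact hx (hm.le_of_ge (y := insert x m) hP (Set.subset_insert _ _) (Set.mem_insert _ _))

/-! ### Classical completeness and countability of the languages -/

namespace CPLForm

variable {V : Type u}

/-- Assuming `∼φ`, the second hypothesis refutes `∼ψ` and the first refutes `ψ`, a contradiction. -/
theorem Deriv.of_cases {Γ : Set (CPLForm V)} {φ ψ : CPLForm V} (h₁ : Deriv (insert ψ Γ) φ)
    (h₂ : Deriv (insert (neg ψ) Γ) φ) : Deriv Γ φ := by
  have aux {χ : CPLForm V} : insert χ Γ ⊆ insert χ (insert (neg φ) Γ) :=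
    Set.insert_subset_insert (Set.subset_insert _ _)
  have hn {χ : CPLForm V} : Deriv (insert χ (insert (neg φ) Γ)) (neg φ) :=
    .hyp (.inr (.inl rfl))
  exact .raa (.raa (h₂.weaken aux) hn) (.negI (h₁.weaken aux) hn)

/-- Completeness of natural deduction for classical propositional logic. -/
theorem Deriv.of_valid {φ : CPLForm V} (h : ∀ v : V → Prop, Holds v φ) : Provable φ := by
  by_contra hφ
  obtain ⟨m, -, hm, hmax⟩ := exists_maximal_not_of_finitary (fun s => Deriv s φ)
    (fun s t hst d => d.weaken hst) (fun s d => d.exists_finite) (s := ∅) hφ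
  have closed {ψ : CPLForm V} (d : Deriv m ψ) : ψ ∈ m := by
    by_contra hψ
    exact hm (.of_cases (hmax ψ hψ)
      (.raa (ψ := ψ) (d.weaken ((Set.subset_insert _ _).trans (Set.subset_insert _ _)))
        (.hyp (.inr (.inl rfl)))))
  have hneg (ψ : CPLForm V) : neg ψ ∈ m ↔ ψ ∉ m := by
    refine ⟨fun h₁ h₂ => hm (.raa (ψ := ψ) (.hyp (.inr h₂)) (.hyp (.inr h₁))), fun h₁ => ?_⟩
    by_contra h₂
    exact hm (.of_cases (hmax _ h₁) (hmax _ h₂))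
  have truth (ψ : CPLForm V) : Holds (fun p => var p ∈ m) ψ ↔ ψ ∈ m := by
    induction ψ with
    | var p => rfl
    | neg ψ ih => rw [hneg, ← ih]; rfl
    | and ψ χ ih₁ ih₂ =>
      change (_ ∧ _) ↔ _
      rw [ih₁, ih₂]
      exact ⟨fun h => closed (.andI (.hyp h.1) (.hyp h.2)),
        fun h => ⟨closed (.andE₁ (.hyp h)), closed (.andE₂ (.hyp h))⟩⟩
  exact hm (.hyp ((truth φ).1 (h _)))

theorem holds_imp {v : V → Prop} {φ ψ : CPLForm V} :
    Holds v (imp φ ψ) ↔ (Holds v φ → Holds v ψ) := by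
  simp [imp, Holds]

instance [Countable V] : Countable (CPLForm V) := by
  obtain ⟨f, hf⟩ := exists_injective_nat V
  let enc : CPLForm V → ℕ := fun φ =>
    CPLForm.rec (fun p => Nat.pair 0 (f p)) (fun _ a => Nat.pair 1 a)
      (fun _ _ a b => Nat.pair 2 (Nat.pair a b)) φ
  refine Function.Injective.countable (f := enc) fun φ => ?_
  induction φ with
  | var p => rintro (_ | _ | _) h <;> simp_all [enc, hf.eq_iff]
  | neg φ ih => rintro (_ | _ | _) h <;> simp_all [enc]; exact ih rfl
  | and φ ψ ih₁ ih₂ =>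
    rintro (_ | _ | _) h <;> simp_all [enc]; exact ⟨ih₁ rfl, ih₂ rfl⟩

end CPLForm

namespace QGForm

variable {V : Type u}

instance [Countable V] : Countable (QGForm V) := by
  obtain ⟨f, hf⟩ := exists_injective_nat (CPLForm V)
  let enc : QGForm V → ℕ := fun φ =>
    QGForm.rec (fun p => Nat.pair 0 (f p))
      (fun _ _ a b => Nat.pair 1 (Nat.pair a b)) (fun _ _ a b => Nat.pair 2 (Nat.pair a b))
      (fun _ _ a b => Nat.pair 3 (Nat.pair a b)) (fun _ _ a b => Nat.pair 4 (Nat.pair a b)) φ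
  refine Function.Injective.countable (f := enc) fun φ => ?_
  induction φ with
  | bel p => rintro (_ | _ | _ | _ | _) h <;> simp_all [enc, hf.eq_iff]
  | and φ ψ ih₁ ih₂ | or φ ψ ih₁ ih₂ | imp φ ψ ih₁ ih₂ | coimp φ ψ ih₁ ih₂ =>
    rintro (_ | _ | _ | _ | _) h <;> simp_all [enc]; exact ⟨ih₁ rfl, ih₂ rfl⟩

end QGForm

/-! ### Derived rules and the laws of `△` -/

namespace QGDerivable

open QGForm

variable {V : Type u} {Ξ : Set (QGForm V)} {α β γ : QGForm V}

theorem weaken (h : QGDerivable Ξ α) : ∀ {Δ : Set (QGForm V)}, Ξ ⊆ Δ → QGDerivable Δ α := by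
  induction h with
  | hyp h => exact fun hs => .hyp (hs h)
  | biG h => exact fun _ => .biG h
  | nontriv τ hφ hχ => exact fun _ => .nontriv τ hφ hχ
  | reg h => exact fun _ => .reg h
  | mp _ _ ih₁ ih₂ => exact fun hs => .mp (ih₁ hs) (ih₂ hs)
  | nec τ h _ => exact fun _ => .nec τ h

theorem thm (h : QGDerivable ∅ α) : QGDerivable Ξ α := h.weaken (Set.empty_subset _)

theorem exists_finite (h : QGDerivable Ξ α) : ∃ s ⊆ Ξ, s.Finite ∧ QGDerivable s α := by
  induction h with
  | @hyp Ξ α h => exact ⟨{α}, Set.singleton_subset_iff.2 h, Set.finite_singleton _, .hyp rfl⟩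
  | biG h => exact ⟨∅, Set.empty_subset _, Set.finite_empty, .biG h⟩
  | nontriv τ hφ hχ => exact ⟨∅, Set.empty_subset _, Set.finite_empty, .nontriv τ hφ hχ⟩
  | reg h => exact ⟨∅, Set.empty_subset _, Set.finite_empty, .reg h⟩
  | mp _ _ ih₁ ih₂ =>
    obtain ⟨s, hs, fs, ds⟩ := ih₁
    obtain ⟨t, ht, ft, dt⟩ := ih₂
    exact ⟨s ∪ t, Set.union_subset hs ht, fs.union ft,
      .mp (ds.weaken Set.subset_union_left) (dt.weaken Set.subset_union_right)⟩
  | nec τ h _ => exact ⟨∅, Set.empty_subset _, Set.finite_empty, .nec τ h⟩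

theorem imp_const (h : QGDerivable Ξ α) (β : QGForm V) : QGDerivable Ξ (imp β α) :=
  .mp h (.mp (.biG (.andE₁ α β)) (.biG (.curry α β α)))

theorem imp_self (α : QGForm V) : QGDerivable Ξ (imp α α) :=
  .mp (.biG (.andE₁ α α)) (.mp (.biG (.andE₂ _ α)) (.biG (.curry _ α α)))

theorem and_intro (h₁ : QGDerivable Ξ α) (h₂ : QGDerivable Ξ β) : QGDerivable Ξ (and α β) :=
  .mp h₁ (.mp (imp_const h₂ α) (.mp (imp_self α) (.biG (.andI α α β))))

theorem imp_mp (h₁ : QGDerivable Ξ (imp α (imp β γ))) (h₂ : QGDerivable Ξ (imp α β)) :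
    QGDerivable Ξ (imp α γ) :=
  .mp (.mp h₁ (.biG (.uncurry α β γ)))
    (.mp (.mp h₂ (.mp (imp_self α) (.biG (.andI α α β)))) (.biG (.trans _ _ _)))

/-- Holds because necessitation applies only to theorems, so its conclusions never depend on `α`. -/
theorem deduction (h : QGDerivable (insert α Ξ) β) : QGDerivable Ξ (imp α β) := by
  generalize hΔ : insert α Ξ = Δ at h
  induction h with
  | hyp h =>
    subst hΔ
    rcases h with rfl | h
    · exact imp_self _
    · exact imp_const (.hyp h) _
  | biG h => exact imp_const (.biG h) _
  | nontriv τ hφ hχ => exact imp_const (.nontriv τ hφ hχ) _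
  | reg h => exact imp_const (.reg h) _
  | mp _ _ ih₁ ih₂ => exact imp_mp (ih₂ hΔ) (ih₁ hΔ)
  | nec τ h _ => exact imp_const (.nec τ h) _

theorem assumed : QGDerivable (insert α Ξ) α := .hyp (Set.mem_insert _ _)

theorem insert (h : QGDerivable Ξ α) (β : QGForm V) : QGDerivable (insert β Ξ) α :=
  h.weaken (Set.subset_insert _ _)

theorem or_inl (h : QGDerivable Ξ α) (β : QGForm V) : QGDerivable Ξ (or α β) :=
  .mp h (.biG (.orI₁ α β))

theorem or_inr (h : QGDerivable Ξ β) (α : QGForm V) : QGDerivable Ξ (or α β) :=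
  .mp h (.biG (.orI₂ α β))

theorem or_elim (h : QGDerivable Ξ (or α β)) (h₁ : QGDerivable (Insert.insert α Ξ) γ)
    (h₂ : QGDerivable (Insert.insert β Ξ) γ) : QGDerivable Ξ γ :=
  .mp h (.mp h₂.deduction (.mp h₁.deduction (.biG (.orE α β γ))))

theorem imp_trans (h₁ : QGDerivable Ξ (imp α β)) (h₂ : QGDerivable Ξ (imp β γ)) :
    QGDerivable Ξ (imp α γ) :=
  .mp h₂ (.mp h₁ (.biG (.trans α β γ)))

/-- One half of the residuation law of co-implication, as a rule for theorems. -/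
theorem coimp_imp (h : QGDerivable ∅ (imp α (or β γ))) :
    QGDerivable ∅ (imp (coimp α β) γ) := by
  have h₁ : QGDerivable ∅ (neg α (coimp α (or β γ))) :=
    .mp (.nec α h) (.mp (.biG (.coimp_top α α (or β γ))) (.biG (.contra α _ _)))
  have h₂ : QGDerivable ∅ (neg α (coimp (coimp α β) γ)) :=
    .mp h₁ (.mp (.biG (.coimp_coimp α β γ)) (.biG (.contra α _ _)))
  exact .mp h₂ (.biG (.neg_coimp α _ _))

theorem bot_imp (τ α : QGForm V) : QGDerivable Ξ (imp (bot τ) α) :=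
  thm (coimp_imp (.biG (.orI₁ τ α)))

/-- Weak excluded middle. -/
theorem neg_or_neg_neg (τ α : QGForm V) : QGDerivable Ξ (or (neg τ α) (neg τ (neg τ α))) := by
  refine or_elim (.biG (.prel α (neg τ α))) (or_inl (deduction ?_) _) (or_inr (deduction ?_) _)
  · exact .mp assumed (.mp assumed (assumed.insert _))
  · exact .mp (.mp assumed (assumed.insert _)) assumed

theorem neg_or_neg_of_neg_and {τ : QGForm V} (h : QGDerivable Ξ (neg τ (and α β))) :
    QGDerivable Ξ (or (neg τ α) (neg τ β)) := by
  refine or_elim (.biG (.prel α β)) (or_inl (deduction ?_) _) (or_inr (deduction ?_) _)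
  · exact .mp (and_intro assumed (.mp assumed (assumed.insert _))) ((h.insert _).insert _)
  · exact .mp (and_intro (.mp assumed (assumed.insert _)) assumed) ((h.insert _).insert _)

theorem or_top_coimp (τ α : QGForm V) : QGDerivable Ξ (or α (coimp (top τ) α)) :=
  .mp (imp_self τ) (.biG (.coimp_or (top τ) α))

/-- Residuation turns the hypothesis into `(⊤ ⤙ α) → ¬¬β`, so `¬β` refutes `⊤ ⤙ α`. This is the
source of the laws that introduce `△`. -/
theorem neg_imp_delta {τ : QGForm V} (h : QGDerivable ∅ (or α (neg τ (neg τ β)))) :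
    QGDerivable ∅ (imp (neg τ β) (delta τ α)) := by
  have h₁ : QGDerivable ∅ (imp (coimp (top τ) α) (neg τ (neg τ β))) :=
    coimp_imp (imp_const h _)
  exact deduction (deduction (.mp (assumed.insert _) (.mp assumed (thm h₁))))

theorem delta_imp_delta_delta (τ α : QGForm V) :
    QGDerivable ∅ (imp (delta τ α) (delta τ (delta τ α))) :=
  neg_imp_delta (neg_or_neg_neg τ (coimp (top τ) α))

theorem delta_imp (τ α : QGForm V) : QGDerivable ∅ (imp (delta τ α) α) :=
  deduction (or_elim (or_top_coimp τ α) assumed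
    (.mp (.mp assumed (assumed.insert _)) (bot_imp τ α)))

theorem delta_imp_distrib (τ α β : QGForm V) :
    QGDerivable ∅ (imp (delta τ (imp α β)) (imp (delta τ α) (delta τ β))) := by
  have h : QGDerivable ∅ (imp (coimp (top τ) β)
      (or (coimp (top τ) (imp α β)) (coimp (top τ) α))) := by
    refine coimp_imp (imp_const ?_ _)
    refine or_elim (or_top_coimp τ α) (or_elim (or_top_coimp τ (imp α β)) (or_inl ?_ _)
      (or_inr (or_inl assumed _) _)) (or_inr (or_inr assumed _) _)
    exact .mp (assumed.insert _) assumed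
  refine deduction (deduction (deduction (or_elim (.mp assumed (thm h)) ?_ ?_)))
  · exact .mp assumed (((assumed.insert _).insert _).insert _)
  · exact .mp assumed ((assumed.insert _).insert _)

/-- The axiom `¬((α ⤙ β) ∧ (β ⤙ α))` splits by prelinearity, and `¬(α ⤙ β)` yields `△(α → β)` by
weak excluded middle. -/
theorem delta_imp_or_delta_imp (τ α β : QGForm V) :
    QGDerivable ∅ (or (delta τ (imp α β)) (delta τ (imp β α))) := by
  have h (α β : QGForm V) : QGDerivable ∅ (imp (neg τ (coimp α β)) (delta τ (imp α β))) :=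
    neg_imp_delta (or_elim (neg_or_neg_neg τ (coimp α β))
      (or_inl (.mp assumed (.biG (.neg_coimp τ α β))) _) (or_inr assumed _))
  exact or_elim (neg_or_neg_of_neg_and (.biG (.coprel τ α β)))
    (or_inl (.mp assumed (thm (h α β))) _) (or_inr (.mp assumed (thm (h β α))) _)

end QGDerivable

/-! ### Prime theories and their total preorder -/

open QGForm

/-- A deductively closed, prime and proper set of two-layered formulas. -/
structure PrimeTheory (V : Type u) where
  /-- the underlying set of formulas -/
  carrier : Set (QGForm V)
  closed : ∀ α, QGDerivable carrier α → α ∈ carrier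
  prime : ∀ α β, QGForm.or α β ∈ carrier → α ∈ carrier ∨ β ∈ carrier
  proper : ∃ α, α ∉ carrier

theorem exists_primeTheory {V : Type u} {Ξ : Set (QGForm V)} {α : QGForm V}
    (h : ¬ QGDerivable Ξ α) : ∃ F : PrimeTheory V, Ξ ⊆ F.carrier ∧ α ∉ F.carrier := by
  obtain ⟨m, hΞ, hm, hmax⟩ := exists_maximal_not_of_finitary (fun s => QGDerivable s α)
    (fun s t hst d => d.weaken hst) (fun s d => d.exists_finite) h
  have hα : α ∉ m := fun h => hm (.hyp h)
  refine ⟨⟨m, fun β hβ => ?_, fun β γ hβγ => ?_, α, hα⟩, hΞ, hα⟩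
  · by_contra hn
    exact hm (.mp hβ (hmax β hn).deduction)
  · by_contra! hn
    exact hm (.or_elim (.hyp hβγ) (hmax β hn.1) (hmax γ hn.2))

namespace PrimeTheory

open QGDerivable

variable {V : Type u} (F : PrimeTheory V) (τ : QGForm V) {α β γ : QGForm V}

theorem mem_of_imp (h : QGDerivable ∅ (imp α β)) (hα : α ∈ F.carrier) : β ∈ F.carrier :=
  F.closed _ (.mp (.hyp hα) (thm h))

/-- The preorder on formulas given by `△(α → β)` being in the theory. -/
def le (α β : QGForm V) : Prop := delta τ (imp α β) ∈ F.carrier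

variable {F τ}

theorem delta_mem_of_imp (h : QGDerivable ∅ (imp α β)) (hα : delta τ α ∈ F.carrier) :
    delta τ β ∈ F.carrier :=
  F.mem_of_imp (.mp (.nec τ h) (delta_imp_distrib τ α β)) hα

theorem delta_mem_of_imp_imp (h : QGDerivable ∅ (imp α (imp β γ))) (hα : delta τ α ∈ F.carrier)
    (hβ : delta τ β ∈ F.carrier) : delta τ γ ∈ F.carrier :=
  F.closed _ (.mp (.hyp hβ) (.mp (.hyp (delta_mem_of_imp h hα)) (thm (delta_imp_distrib τ β γ))))

theorem le_of_imp (h : QGDerivable ∅ (imp α β)) : F.le τ α β :=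
  F.closed _ (.nec τ h)

theorem le_refl (α : QGForm V) : F.le τ α α := le_of_imp (imp_self α)

theorem le_trans (h₁ : F.le τ α β) (h₂ : F.le τ β γ) : F.le τ α γ :=
  delta_mem_of_imp_imp (.biG (.trans α β γ)) h₁ h₂

theorem le_total (α β : QGForm V) : F.le τ α β ∨ F.le τ β α :=
  F.prime _ _ (F.closed _ (thm (delta_imp_or_delta_imp τ α β)))

theorem mem_of_le (h : F.le τ α β) (hα : α ∈ F.carrier) : β ∈ F.carrier :=
  F.closed _ (.mp (.hyp hα) (.mp (.hyp h) (thm (delta_imp τ _))))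

theorem le_and (h₁ : F.le τ γ α) (h₂ : F.le τ γ β) : F.le τ γ (and α β) :=
  delta_mem_of_imp_imp (.biG (.andI γ α β)) h₁ h₂

theorem or_le (h₁ : F.le τ α γ) (h₂ : F.le τ β γ) : F.le τ (or α β) γ :=
  delta_mem_of_imp_imp (.biG (.orE α β γ)) h₁ h₂

theorem le_imp_of_le (h : F.le τ α β) (γ : QGForm V) : F.le τ γ (imp α β) :=
  delta_mem_of_imp (deduction (imp_const assumed _)) h

/-- Compare `α → β` with `α`: in either direction contraction applies, giving `(α → β) ≤ β` or the
excluded `α ≤ β`. -/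
theorem imp_le_of_not_le (h : ¬ F.le τ α β) : F.le τ (imp α β) β := by
  rcases F.le_total (τ := τ) (imp α β) α with h₁ | h₁
  · refine delta_mem_of_imp (deduction (deduction ?_)) h₁
    exact .mp (.mp assumed (assumed.insert _)) assumed
  · refine absurd (delta_mem_of_imp (deduction (deduction ?_)) h₁) h
    exact .mp assumed (.mp assumed (assumed.insert _))

theorem coimp_le_of_le (h : F.le τ α β) (γ : QGForm V) : F.le τ (coimp α β) γ := by
  have h₁ : QGDerivable ∅ (imp (delta τ (imp α β)) (neg τ (coimp α β))) :=
    .mp (.biG (.coimp_top τ α β)) (.biG (.contra τ _ _))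
  -- `α ≤ β` supplies only one `△`, which is spent on `¬(α ⤙ β)`; the law `△α → △△α` keeps another
  -- for the conclusion.
  refine delta_mem_of_imp (α := delta τ (imp α β)) (imp_trans h₁ ?_)
    (F.mem_of_imp (delta_imp_delta_delta τ _) h)
  exact deduction (deduction (.mp (.mp assumed (assumed.insert _)) (bot_imp τ γ)))

theorem coimp_le (α β : QGForm V) : F.le τ (coimp α β) α :=
  le_of_imp (coimp_imp (.biG (.orI₂ β α)))

theorem le_coimp_of_not_le (h : ¬ F.le τ α β) : F.le τ α (coimp α β) := by
  have h₁ : F.le τ α (or β (coimp α β)) := le_of_imp (.biG (.coimp_or α β))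
  rcases F.le_total (τ := τ) β (coimp α β) with h₂ | h₂
  · exact le_trans h₁ (or_le h₂ (le_refl _))
  · exact absurd (le_trans h₁ (or_le (le_refl _) h₂)) h

theorem top_mem (F : PrimeTheory V) (τ : QGForm V) : top τ ∈ F.carrier :=
  F.closed _ (imp_self τ)

theorem bot_notMem (F : PrimeTheory V) (τ : QGForm V) : bot τ ∉ F.carrier := fun h => by
  obtain ⟨α, hα⟩ := F.proper
  exact hα (F.mem_of_imp (bot_imp τ α) h)

end PrimeTheory

/-! ### Representation in `[0,1]` and the canonical model -/

/-- A countable total preorder is represented by a real-valued function. -/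
theorem exists_real_representation {X : Type*} [Countable X] (r : X → X → Prop)
    (refl : ∀ a, r a a) (trans : ∀ a b c, r a b → r b c → r a c)
    (total : ∀ a b, r a b ∨ r b a) : ∃ k : X → ℝ, ∀ a b, k a ≤ k b ↔ r a b := by
  classical
  let _ : Preorder X := { le := r, le_refl := refl, le_trans := trans }
  have : Std.Total (α := X) (· ≤ ·) := ⟨total⟩
  have : Countable (Antisymmetrization X (· ≤ ·)) :=
    Quotient.countable
  obtain ⟨f⟩ := Order.embedding_from_countable_to_dense (Antisymmetrization X (· ≤ ·)) ℝ
  exact ⟨fun a => f (toAntisymmetrization (· ≤ ·) a), fun a b => by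
    rw [f.le_iff_le, toAntisymmetrization_le_toAntisymmetrization_iff]; rfl⟩

/-- The order of a prime theory is represented in the unit interval, with the endpoints
preserved and a positive gap between the members and the non-members of the theory. -/
theorem PrimeTheory.exists_unitInterval_representation {V : Type u} [Countable V]
    (F : PrimeTheory V) (τ : QGForm V) : ∃ g : QGForm V → unitInterval,
      (∀ α β, g α ≤ g β ↔ F.le τ α β) ∧ g (top τ) = 1 ∧ g (bot τ) = 0 ∧
      ∀ α ∉ F.carrier, ∃ c, g α < c ∧ ∀ β ∈ F.carrier, c ≤ g β := by
  classical
  obtain ⟨k, hk⟩ := exists_real_representation (F.le τ) le_refl (fun _ _ _ => le_trans) le_total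
  -- Members lie strictly above non-members, so raising them by 1 keeps the order and opens a gap of
  -- at least 1.
  let k' : QGForm V → ℝ := fun α => k α + if α ∈ F.carrier then 1 else 0
  have hgap {α β : QGForm V} (hα : α ∉ F.carrier) (hβ : β ∈ F.carrier) : k' α + 1 ≤ k' β := by
    have : ¬ k β ≤ k α := fun h => hα (mem_of_le ((hk _ _).1 h) hβ)
    simp only [k', hα, hβ, if_true, if_false]
    linarith
  have hk' (α β : QGForm V) : k' α ≤ k' β ↔ F.le τ α β := by
    by_cases hα : α ∈ F.carrier <;> by_cases hβ : β ∈ F.carrier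
    · simp [k', hα, hβ, hk]
    · exact iff_of_false (by linarith [hgap hβ hα]) fun h => hβ (mem_of_le h hα)
    · have := hgap hα hβ
      refine iff_of_true (by linarith) ((le_total α β).resolve_right fun h => hα (mem_of_le h hβ))
    · simp [k', hα, hβ, hk]
  have hbot (α : QGForm V) : k' (bot τ) ≤ k' α :=
    (hk' _ _).2 (le_of_imp (QGDerivable.bot_imp τ α))
  have htop (α : QGForm V) : k' α ≤ k' (top τ) :=
    (hk' _ _).2 (le_of_imp (.imp_const (.imp_self τ) α))
  have hd : 0 < k' (top τ) - k' (bot τ) := by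
    linarith [hgap (F.bot_notMem τ) (F.top_mem τ)]
  have hmem (x : ℝ) (h₀ : k' (bot τ) ≤ x) (h₁ : x ≤ k' (top τ)) :
      (x - k' (bot τ)) / (k' (top τ) - k' (bot τ)) ∈ unitInterval :=
    ⟨div_nonneg (by linarith) hd.le, (div_le_one hd).2 (by linarith)⟩
  refine ⟨fun α => ⟨_, hmem (k' α) (hbot α) (htop α)⟩, fun α β => ?_, ?_, ?_, fun α hα => ?_⟩
  · rw [Subtype.mk_le_mk, div_le_div_iff_of_pos_right hd, sub_le_sub_iff_right, hk']
  · exact Subtype.ext (div_self hd.ne')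
  · exact Subtype.ext (by simp)
  · refine ⟨⟨_, hmem (k' α + 1) (by linarith [hbot α]) (hgap hα (F.top_mem τ))⟩, ?_,
      fun β hβ => ?_⟩
    · rw [Subtype.mk_lt_mk, div_lt_div_iff_of_pos_right hd]
      linarith
    · rw [Subtype.mk_le_mk, div_le_div_iff_of_pos_right hd]
      linarith [hgap hα hβ]

theorem QGModel.sat_iff_holds {V : Type u} (M : QGModel.{u, w} V) (x : M.W) (φ : CPLForm V) :
    M.Sat x φ ↔ φ.Holds fun p => x ∈ M.v p := by
  induction φ with
  | var p => rfl
  | neg φ ih => exact not_congr ih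
  | and φ ψ ih₁ ih₂ => exact and_congr ih₁ ih₂

theorem QGForm.nonempty_cplForm {V : Type u} (α : QGForm V) : Nonempty (CPLForm V) := by
  induction α with
  | bel φ => exact ⟨φ⟩
  | _ => assumption

/-- A prime theory has a model that realizes its order, with a positive gap between the values
of the members and of the non-members. -/
theorem PrimeTheory.exists_model {V : Type u} [Countable V] (F : PrimeTheory V) :
    ∃ M : QGModel.{u, w} V, ∀ α ∉ F.carrier, ∃ c, M.eval α < c ∧ ∀ β ∈ F.carrier, c ≤ M.eval β := by
  classical
  obtain ⟨τ, -⟩ := F.proper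
  obtain ⟨g, hg, htop, hbot, hgap⟩ := F.exists_unitInterval_representation τ
  obtain ⟨f, hf⟩ := exists_injective_nat V
  obtain ⟨φ₀⟩ := τ.nonempty_cplForm
  -- Countability lets valuations be coded by `ℕ → Prop`, which `ULift` places in any universe `w`,
  -- whatever that of `V`.
  let E (φ : CPLForm V) : Set (ULift.{w} (ℕ → Prop)) := {x | φ.Holds fun p => x.down (f p)}
  have hE {φ ψ : CPLForm V} (h : E φ ⊆ E ψ) : g (bel φ) ≤ g (bel ψ) := by
    refine (hg _ _).2 (le_of_imp (.reg (.of_valid fun v => CPLForm.holds_imp.2 fun hφ => ?_)))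
    have hv : (fun p => Function.extend f v (fun _ => False) (f p)) = v :=
      funext fun p => hf.extend_apply _ _ _
    have := @h ⟨Function.extend f v fun _ => False⟩
    simp only [E, Set.mem_ofPred_eq, hv] at this
    exact this hφ
  -- The least monotone set function with at least the prescribed values on definable events; `hE`
  -- makes it agree with them there.
  let m (X : Set (ULift.{w} (ℕ → Prop))) : unitInterval := sSup {c | ∃ φ, E φ ⊆ X ∧ c = g (bel φ)}
  have hm (φ : CPLForm V) : m (E φ) = g (bel φ) := by
    refine le_antisymm (sSup_le ?_) (le_sSup ⟨φ, subset_rfl, rfl⟩)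
    rintro _ ⟨ψ, hψ, rfl⟩
    exact hE hψ
  let φ₁ := CPLForm.and φ₀ φ₀.neg
  have hempty : E φ₁ = ∅ := by ext x; simp [E, φ₁, CPLForm.Holds]
  have huniv : E φ₁.neg = Set.univ := by ext x; simp [E, φ₁, CPLForm.Holds]
  have hprov : φ₁.neg.Provable := .of_valid fun v => by simp [φ₁, CPLForm.Holds]
  let M : QGModel.{u, w} V :=
    { W := ULift.{w} (ℕ → Prop)
      nonempty := inferInstance
      v := fun p => {x | x.down (f p)}
      μ :=
        { toFun := m
          mono := fun X Y h => sSup_le_sSup fun c ⟨φ, hφ, hc⟩ => ⟨φ, hφ.trans h, hc⟩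
          nontrivial := by
            rw [← hempty, ← huniv, hm, hm, ← not_le, hg]
            -- Triviality would put `△(B ∼φ₁ → B φ₁)` in `F`, against (nontriv).
            exact fun h => F.bot_notMem τ (F.closed _ (.mp (.hyp h) (.nontriv τ hprov hprov))) } }
  have hMm (φ : CPLForm V) : M.ext φ = E φ := Set.ext fun x => M.sat_iff_holds x φ
  have le_iff {α β : QGForm V} : F.le τ α β ↔ g α ≤ g β := (hg α β).symm
  have heval (α : QGForm V) : M.eval α = g α := by
    induction α with
    | bel φ => rw [QGModel.eval, hMm]; exact hm φ
    | and α β ih₁ ih₂ =>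
      rw [QGModel.eval, ih₁, ih₂]
      refine le_antisymm ?_ (le_min (le_iff.1 (le_of_imp (.biG (.andE₁ α β))))
        (le_iff.1 (le_of_imp (.biG (.andE₂ α β)))))
      rcases _root_.le_total (g α) (g β) with h | h
      · rw [min_eq_left h]; exact le_iff.1 (le_and (le_refl _) (le_iff.2 h))
      · rw [min_eq_right h]; exact le_iff.1 (le_and (le_iff.2 h) (le_refl _))
    | or α β ih₁ ih₂ =>
      rw [QGModel.eval, ih₁, ih₂]
      refine le_antisymm (max_le (le_iff.1 (le_of_imp (.biG (.orI₁ α β))))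
        (le_iff.1 (le_of_imp (.biG (.orI₂ α β))))) ?_
      rcases _root_.le_total (g α) (g β) with h | h
      · rw [max_eq_right h]; exact le_iff.1 (or_le (le_iff.2 h) (le_refl _))
      · rw [max_eq_left h]; exact le_iff.1 (or_le (le_refl _) (le_iff.2 h))
    | imp α β ih₁ ih₂ =>
      rw [QGModel.eval, ih₁, ih₂, goedelImp]
      split_ifs with h
      · exact le_antisymm (htop ▸ le_iff.1 (le_imp_of_le (le_iff.2 h) (top τ))) le_top
      · exact le_antisymm (le_iff.1 (le_of_imp (.deduction (.imp_const .assumed _))))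
          (le_iff.1 (imp_le_of_not_le (mt le_iff.1 h)))
    | coimp α β ih₁ ih₂ =>
      rw [QGModel.eval, ih₁, ih₂, goedelCoimp]
      split_ifs with h
      · exact le_antisymm bot_le (hbot ▸ le_iff.1 (coimp_le_of_le (le_iff.2 h) (bot τ)))
      · exact le_antisymm (le_iff.1 (le_coimp_of_not_le (mt le_iff.1 h)))
          (le_iff.1 (coimp_le α β))
  exact ⟨M, by simpa only [heval] using hgap⟩

/-! ### Soundness and the main equivalence -/

theorem CPLForm.Provable.sat {V : Type u} {φ : CPLForm V} (h : φ.Provable)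
    (M : QGModel.{u, w} V) (x : M.W) : M.Sat x φ :=
  (M.sat_iff_holds x φ).2 (Deriv.sound h _ fun _ h => h.elim)

theorem le_goedelImp {a b c : unitInterval} : c ≤ goedelImp a b ↔ min c a ≤ b := by
  unfold goedelImp
  split_ifs with h
  · simp [h, unitInterval.le_one']
  · simp [h]

theorem one_le_goedelImp {a b : unitInterval} : 1 ≤ goedelImp a b ↔ a ≤ b := by
  rw [le_goedelImp, min_eq_right unitInterval.le_one']

theorem BiGAxiom.sound {V : Type u} {α : QGForm V} (h : BiGAxiom α) (M : QGModel.{u, w} V) :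
    1 ≤ M.eval α := by
  have h₀ (x : unitInterval) : 0 ≤ x := unitInterval.nonneg'
  have h₁ (x : unitInterval) : x ≤ 1 := unitInterval.le_one'
  cases h <;> simp only [QGModel.eval, top, bot, neg, one_le_goedelImp] <;>
    (try simp only [goedelImp, goedelCoimp, le_refl, if_true]) <;> grind

theorem QGModel.eval_delta {V : Type u} (M : QGModel.{u, w} V) (τ α : QGForm V) :
    M.eval (delta τ α) = if M.eval α = 1 then 1 else 0 := by
  have h : (1 : unitInterval) ≤ M.eval α ↔ M.eval α = 1 :=
    ⟨fun h => le_antisymm unitInterval.le_one' h, fun h => h.ge⟩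
  by_cases hα : M.eval α = 1 <;>
    simp [QGModel.eval, delta, top, bot, goedelImp, goedelCoimp, h, hα]

/-- Quantifying over lower bounds `c` avoids infima: modus ponens becomes residuation of `min`, and
necessitation uses `c = 1` with no premises. -/
theorem QGDerivable.sound {V : Type u} {Ξ : Set (QGForm V)} {α : QGForm V}
    (h : QGDerivable Ξ α) (M : QGModel.{u, w} V) :
    ∀ c, (∀ γ ∈ Ξ, c ≤ M.eval γ) → c ≤ M.eval α := by
  induction h with
  | hyp h => exact fun c hc => hc _ h
  | biG h => exact fun c _ => unitInterval.le_one'.trans (h.sound M)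
  | @nontriv Ξ τ φ χ hφ hχ =>
    have h₁ : M.ext φ = Set.univ := Set.eq_univ_of_forall fun x => hφ.sat M x
    have h₂ : M.ext χ = ∅ := Set.eq_empty_of_forall_notMem fun x => hχ.sat M x
    have h₃ : M.eval (imp (bel φ) (bel χ)) ≠ 1 := fun h => by
      have := one_le_goedelImp.1 h.ge
      rw [QGModel.eval, QGModel.eval, h₁, h₂] at this
      exact this.not_gt M.μ.nontrivial
    intro c _
    refine unitInterval.le_one'.trans (one_le_goedelImp.2 ?_)
    rw [QGModel.eval_delta, if_neg h₃]
    exact unitInterval.nonneg'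
  | @reg Ξ φ ψ h =>
    intro c _
    refine unitInterval.le_one'.trans (one_le_goedelImp.2 (M.μ.mono _ _ fun x hx => ?_))
    rw [QGModel.ext, Set.mem_ofPred_eq, M.sat_iff_holds] at hx ⊢
    exact CPLForm.holds_imp.1 ((M.sat_iff_holds _ _).1 (h.sat M x)) hx
  | mp _ _ ih₁ ih₂ =>
    intro c hc
    exact (le_min le_rfl (ih₁ c hc)).trans (le_goedelImp.1 (ih₂ c hc))
  | nec τ _ ih =>
    intro c _
    rw [QGModel.eval_delta,
      if_pos (le_antisymm unitInterval.le_one' (ih 1 fun _ h => h.elim))]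
    exact unitInterval.le_one'

theorem mainTheorem1 {V : Type u} [Countable V] (Ξ : Set (QGForm V)) (α : QGForm V) :
    QGEntails.{u, w} Ξ α ↔ QGDerivable Ξ α := by
  refine ⟨fun h => ?_, fun h M => h.sound M _ fun γ hγ => sInf_le ⟨γ, hγ, rfl⟩⟩
  by_contra hα
  obtain ⟨F, hΞ, hαF⟩ := exists_primeTheory hα
  obtain ⟨M, hM⟩ := F.exists_model
  obtain ⟨c, hc, hcF⟩ := hM α hαF
  refine (h M).not_gt (hc.trans_le (le_sInf ?_))
  rintro _ ⟨γ, hγ, rfl⟩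
  exact hcF γ (hΞ hγ)
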